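/- Write $\tau=u+iv\in\mathbb H$ and $q=e^{2\pi i\tau}$. For an integer $\kappa$, a harmonic Maass form of weight $\kappa$ on $\mathrm{SL}_2(\mathbb Z)$ is a smooth function $F:\mathbb H\to\mathbb C$ such that $F\!\left(\frac{a\tau+b}{c\tau+d}\right)=(c\tau+d)^{\kappa}F(\tau)$ for all $\left(\begin{smallmatrix}a&b\\c&d\end{smallmatrix}\right)\in\mathrm{SL}_2(\mathbb Z)$, $\Delta_\kappa F=0$ where $\Delta_\kappa=-v^2(\partial_u^2+\partial_v^2)+i\kappa v(\partial_u+i\partial_v)$, and there are a polynomial $P_F\in\mathbb C[X]$ and $\varepsilon>0$ with $F(\tau)-P_F(q^{-1})=O(e^{-\varepsilon v})$ as $v\to\infty$. Such an $F$ has a Fourier expansion $F=\sum_{l\gg-\infty}c_F^+(l)q^l+\sum_{l<0}c_F^-(l)\Gamma(1-\kappa,-4\pi lv)q^l$, with $P_F(q^{-1})=\sum_{l\le 0}c_F^+(l)q^l$. Put $\xi_\kappa F=2iv^\kappa\,\overline{\partial F/\partial\overline\tau}$, and let $$f\,|\,T_\kappa(n)=n^{\kappa-1}\sum_{ad=n,\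 d>0}d^{-\kappa}\sum_{0\le b<d}f\!\left(\frac{a\tau+b}{d}\right)$$ be the weight $\kappa$ Hecke operator. Let $E_4,E_6$ be the normalized Eisenstein series of weights $4$ and $6$, let $\Delta=(E_4^3-E_6^2)/1728$ and $j=E_4^3/\Delta$. For even $\ell$ set $\widetilde E_\ell=1,\ E_4^2E_6,\ E_4,\ E_6,\ E_4^2,\ E_4E_6$ according as $\ell\equiv 0,2,4,6,8,10\pmod{12}$, and $b(\ell)=\lfloor \ell/12\rfloor$ if $\ell\not\equiv2\pmod{12}$, $b(\ell)=\lfloor \ell/12\rfloor-1$ if $\ell\equiv 2\pmod{12}$. **Theorem.** Let $k$ be an even integer and $m\ge1$ an integer. Let $F$ be a weight $2-k$ harmonic Maass form on $\mathrm{SL}_2(\mathbb Z)$ all of whose Fourier coefficients $c_F^{\pm}(l)$ are real, with holomorphic part $\sum_l c_F^+(l)q^l=q^{-m}+O(q^{-m+1})$. Suppose that its shadow $G=\xi_{2-k}F$ is a Hecke eigenform of weight $k$, that is, $G\ne0$ and $G\,|\,T_k(n)=a(n)G$ for all $n\ge1$. Then for every $n\ge2$: (1) the function $$H_n(F;\tau)=\Delta(\tau)^{b(k-2)}\,\widetilde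 E_{k-2}(\tau)\cdot\left(n^{k-1}F(\tau)\,|\,T_{2-k}(n)-a(n)F(\tau)\right)$$ is a weakly holomorphic modular function on $\mathrm{SL}_2(\mathbb Z)$, that is, it is $\mathrm{SL}_2(\mathbb Z)$-invariant, holomorphic on $\mathbb H$, and meromorphic at the cusp; (2) there is a monic polynomial $P_n(F;x)\in\mathbb R[x]$ of degree $mn-b(k-2)$ such that $P_n(F;j(\tau))=H_n(F;\tau)$ for all $\tau\in\mathbb H$. -/

import Mathlib

open Complex Filter Asymptotics
open UpperHalfPlane hiding I
open scoped ModularForm MatrixGroups Manifold ContDiff Topology ComplexConjugate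

noncomputable section

namespace WeakEigenform

/-- `q = exp(2πiτ)`. -/
def q (τ : ℍ) : ℂ := cexp (2 * Real.pi * I * τ)

/-- `∂f/∂u`, where `z = u + iv`. -/
def partialU (f : ℂ → ℂ) (z : ℂ) : ℂ := fderiv ℝ f z 1

/-- `∂f/∂v`, where `z = u + iv`. -/
def partialV (f : ℂ → ℂ) (z : ℂ) : ℂ := fderiv ℝ f z I

/-- The Wirtinger derivative `∂f/∂z̄ = (∂f/∂u + i ∂f/∂v) / 2`. -/
def dbar (f : ℂ → ℂ) (z : ℂ) : ℂ := (partialU f z + I * partialV f z) / 2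

/-- The weight `κ` hyperbolic Laplacian
`Δ_κ = -v² (∂²/∂u² + ∂²/∂v²) + iκv (∂/∂u + i ∂/∂v)`. -/
def laplacian (κ : ℤ) (F : ℍ → ℂ) (τ : ℍ) : ℂ :=
  -(τ.im : ℂ) ^ 2 * (partialU (partialU (F ∘ ofComplex)) τ + partialV (partialV (F ∘ ofComplex)) τ)
    + I * κ * τ.im * (partialU (F ∘ ofComplex) τ + I * partialV (F ∘ ofComplex) τ)

/-- The operator `ξ_κ F = 2i v^κ · conj (∂F/∂τ̄)`. -/
def xi (κ : ℤ) (F : ℍ → ℂ) (τ : ℍ) : ℂ :=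
  2 * I * (τ.im : ℂ) ^ κ * conj (dbar (F ∘ ofComplex) τ)

/-- `P(q⁻¹)` is the principal part of `F` at the cusp (including the constant term): the difference
`F - P(q⁻¹)` decays exponentially as `v → ∞`.  The polynomial `P` is determined by `F`. In terms of
the Fourier expansion `F = ∑ c⁺(l) q^l + ∑_{l < 0} c⁻(l) Γ(1 - κ, -4πlv) q^l` of a harmonic Maass
form, it is `P(q⁻¹) = ∑_{l ≤ 0} c⁺(l) q^l`. -/
def HasPrincipalPart (F : ℍ → ℂ) (P : Polynomial ℂ) : Prop :=
  ∃ ε : ℝ, 0 < ε ∧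
    (fun τ : ℍ => F τ - P.eval (q τ)⁻¹) =O[atImInfty] fun τ : ℍ => Real.exp (-ε * τ.im)

/-- Harmonic Maass forms of weight `κ` on `SL₂(ℤ)`: smooth, of weight `κ`, annihilated by `Δ_κ`,
and with a principal part in `ℂ[q⁻¹]` at the cusp. -/
structure IsHarmonicMaassForm (κ : ℤ) (F : ℍ → ℂ) : Prop where
  smooth : ContDiffOn ℝ ∞ (F ∘ ofComplex) upperHalfPlaneSet
  slash_eq : ∀ γ : SL(2, ℤ), F ∣[κ] γ = F
  harmonic : ∀ τ : ℍ, laplacian κ F τ = 0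
  principal : ∃ P : Polynomial ℂ, HasPrincipalPart F P

/-- The `l`-th Fourier coefficient `A_l(v)` of `F` as a function of `u`, that is,
`F(u + iv) = ∑_l A_l(v) exp(2πilu)`. -/
def fourierCoeff (F : ℍ → ℂ) (l : ℤ) (v : ℝ) : ℂ :=
  ∫ u in (0 : ℝ)..1, F (ofComplex (u + v * I)) * cexp (-(2 * Real.pi * I * l * u))

/-- `F` has real Fourier coefficients.  For a harmonic Maass form of weight `κ`,
`A_l(v) = c⁺(l) exp(-2πlv)` if `l ≥ 0` and
`A_l(v) = (c⁺(l) + c⁻(l) Γ(1 - κ, -4πlv)) exp(-2πlv)` if `l < 0`, and the incomplete Gamma function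
decreases strictly to `0`; so all `A_l(v)` are real if and only if all `c⁺(l)` and `c⁻(l)` are. -/
def HasRealFourierCoeffs (F : ℍ → ℂ) : Prop :=
  ∀ (l : ℤ) (v : ℝ), 0 < v → (fourierCoeff F l v).im = 0

/-- The weight `κ` Hecke operator
`f | T_κ(n) = n^(κ-1) ∑_{ad = n} d^(-κ) ∑_{0 ≤ b < d} f((aτ + b)/d)`. -/
def hecke (κ : ℤ) (n : ℕ) (f : ℍ → ℂ) (τ : ℍ) : ℂ :=
  (n : ℂ) ^ (κ - 1) * ∑ p ∈ n.divisorsAntidiagonal,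
    (p.2 : ℂ) ^ (-κ) * ∑ b ∈ Finset.range p.2, f (ofComplex ((p.1 * τ + b) / p.2))

/-- `G` is a Hecke eigenform of weight `k` with `T_k(n)`-eigenvalues `a n`. -/
def IsHeckeEigen (k : ℤ) (G : ℍ → ℂ) (a : ℕ → ℂ) : Prop :=
  G ≠ 0 ∧ ∀ n : ℕ, 1 ≤ n → hecke k n G = a n • G

/-- `F` is a weak Hecke eigenform of weight `2 - k`: a harmonic Maass form with real Fourier
coefficients whose shadow `ξ_{2-k} F` is a Hecke eigenform of weight `k`, with eigenvalues `a n`. -/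
structure IsWeakEigenform (k : ℤ) (F : ℍ → ℂ) (a : ℕ → ℂ) : Prop where
  maass : IsHarmonicMaassForm (2 - k) F
  real : HasRealFourierCoeffs F
  shadow : IsHeckeEigen k (xi (2 - k) F) a

/-- Weakly holomorphic modular functions on `SL₂(ℤ)`: invariant, holomorphic on `ℍ`, and
meromorphic (in the variable `q`) at the cusp. -/
structure IsWeaklyHolomorphicFunction (f : ℍ → ℂ) : Prop where
  invariant : ∀ (γ : SL(2, ℤ)) (τ : ℍ), f (γ • τ) = f τ
  holo : MDiff f
  meromorphic : MeromorphicAt (cuspFunction 1 f) 0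

/-- The exponent `b(k)`. -/
def b (k : ℤ) : ℤ := if k % 12 = 2 then k / 12 - 1 else k / 12

/-- The form `Ẽ_k`. -/
def Etilde (k : ℤ) (τ : ℍ) : ℂ :=
  if k % 12 = 2 then ModularForm.E₄ τ ^ 2 * ModularForm.E₆ τ
  else if k % 12 = 4 then ModularForm.E₄ τ
  else if k % 12 = 6 then ModularForm.E₆ τ
  else if k % 12 = 8 then ModularForm.E₄ τ ^ 2
  else if k % 12 = 10 then ModularForm.E₄ τ * ModularForm.E₆ τ
  else 1

/-- The modular `j`-invariant. -/
def j (τ : ℍ) : ℂ := ModularForm.E₄ τ ^ 3 / ModularForm.discriminant τ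

/-- `H_n(F;τ) = Δ^{b(k-2)} Ẽ_{k-2} · (n^{k-1} F | T_{2-k}(n) - a(n) F)`. -/
def H (k : ℤ) (a : ℕ → ℂ) (n : ℕ) (F : ℍ → ℂ) (τ : ℍ) : ℂ :=
  ModularForm.discriminant τ ^ b (k - 2) * Etilde (k - 2) τ *
    ((n : ℂ) ^ (k - 1) * hecke (2 - k) n F τ - a n * F τ)

end WeakEigenform

end
/-!
The operator `ξ` intertwines `n^(k-1) T_{2-k}(n)` with `T_k(n)`. Real Fourier coefficients mean
that `F(-τ̄) = conj F(τ)`; this symmetry passes to the shadow `G` and commutes with the Hecke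
operators, so the eigenvalue `a(n)` is real and `ξ` annihilates
`D = n^(k-1) F | T_{2-k}(n) - a(n) F`. Hence `D` is holomorphic of weight `2 - k`, and multiplying
it by the form `Δ^b Ẽ` of weight `k - 2` gives an invariant function. At the cusp only the translate
`τ ↦ nτ` contributes a pole of order `mn`, so the product is `q^(b - mn) + ⋯`. Subtracting multiples
of powers of `j` lowers the order of the pole until nothing but a constant is left, and the symmetry
under `τ ↦ -τ̄` makes the coefficients of the resulting polynomial in `j` real.
-/

noncomputable section

namespace WeakEigenform

/-! ### The variable `q` -/

lemma q_eq_qParam (τ : ℍ) : q τ = Function.Periodic.qParam 1 τ := by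
  simp [q, Function.Periodic.qParam]

lemma q_ne_zero (τ : ℍ) : q τ ≠ 0 := Complex.exp_ne_zero _

lemma norm_q (τ : ℍ) : ‖q τ‖ = Real.exp (-2 * Real.pi * τ.im) := by
  rw [q_eq_qParam, Function.Periodic.norm_qParam]
  simp

lemma q_one_vadd (τ : ℍ) : q ((1 : ℝ) +ᵥ τ) = q τ := by
  simp [q, mul_add, Complex.exp_add]

lemma mdifferentiable_q : MDiff q := by
  rw [UpperHalfPlane.mdifferentiable_iff]
  have h : DifferentiableOn ℂ (fun z : ℂ ↦ cexp (2 * Real.pi * I * z)) {z | 0 < z.im} := by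
    fun_prop
  exact h.congr fun z hz ↦ by simp [q, ofComplex_apply_of_im_pos hz]

lemma tendsto_q : Tendsto q atImInfty (𝓝 0) := by
  simpa only [← q_eq_qParam] using UpperHalfPlane.qParam_tendsto_atImInfty one_pos

lemma tendsto_exp_neg_mul_im {c : ℝ} (hc : 0 < c) :
    Tendsto (fun τ : ℍ ↦ Real.exp (-c * τ.im)) atImInfty (𝓝 0) :=
  Real.tendsto_exp_atBot.comp (tendsto_comap.const_mul_atTop_of_neg (neg_neg_of_pos hc))

lemma periodic_comp_ofComplex {f : ℍ → ℂ} (hf : ∀ τ : ℍ, f ((1 : ℝ) +ᵥ τ) = f τ) :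
    Function.Periodic (f ∘ ofComplex) ((1 : ℝ) : ℂ) := by
  intro w
  rcases lt_or_ge 0 w.im with hw | hw
  · have hw' : 0 < (w + ((1 : ℝ) : ℂ)).im := by simpa using hw
    have hshift : (⟨w + ((1 : ℝ) : ℂ), hw'⟩ : ℍ) = (1 : ℝ) +ᵥ ⟨w, hw⟩ := by
      ext
      simp [add_comm]
    simp only [Function.comp_apply, ofComplex_apply_of_im_pos hw, ofComplex_apply_of_im_pos hw',
      hshift, hf]
  · have hw' : (w + ((1 : ℝ) : ℂ)).im ≤ 0 := by simpa using hw
    simp only [Function.comp_apply, ofComplex_apply_of_im_nonpos hw,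
      ofComplex_apply_of_im_nonpos hw']

lemma mdifferentiable_zpow {f : ℍ → ℂ} (hf : MDiff f) (h0 : ∀ τ, f τ ≠ 0) (n : ℤ) :
    MDiff (f ^ n) := by
  rw [UpperHalfPlane.mdifferentiable_iff] at hf ⊢
  exact fun z hz ↦ (hf z hz).zpow (Or.inl (h0 _))

/-! ### Leading terms at the cusp -/

/-- `f` has leading term `c q^N`, that is, `f = (c + o(1)) q^N` as `v → ∞`. The coefficient `c` is
allowed to vanish, in which case this says that `f = o(q^N)`. -/
def HasLeadingTerm (N : ℤ) (c : ℂ) (f : ℍ → ℂ) : Prop :=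
  Tendsto (fun τ ↦ f τ / q τ ^ N) atImInfty (𝓝 c)

lemma hasLeadingTerm_zero_iff {c : ℂ} {f : ℍ → ℂ} :
    HasLeadingTerm 0 c f ↔ Tendsto f atImInfty (𝓝 c) := by
  simp [HasLeadingTerm]

namespace HasLeadingTerm

variable {N M : ℤ} {c d : ℂ} {f g : ℍ → ℂ}

lemma unique (hf : HasLeadingTerm N c f) (hf' : HasLeadingTerm N d f) : c = d :=
  tendsto_nhds_unique hf hf'

lemma mul (hf : HasLeadingTerm N c f) (hg : HasLeadingTerm M d g) :
    HasLeadingTerm (N + M) (c * d) (f * g) :=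
  (Tendsto.mul hf hg).congr fun τ ↦ by
    rw [zpow_add₀ (q_ne_zero τ), div_mul_div_comm, Pi.mul_apply]

lemma pow (hf : HasLeadingTerm N c f) (n : ℕ) : HasLeadingTerm (N * n) (c ^ n) (f ^ n) :=
  (Tendsto.pow hf n).congr fun τ ↦ by rw [div_pow, zpow_mul, zpow_natCast, Pi.pow_apply]

lemma zpow (hf : HasLeadingTerm N c f) (hc : c ≠ 0) (n : ℤ) :
    HasLeadingTerm (N * n) (c ^ n) (f ^ n) :=
  (Tendsto.zpow₀ hf n (Or.inl hc)).congr fun τ ↦ by rw [div_zpow, zpow_mul, Pi.pow_apply]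

lemma const_smul (hf : HasLeadingTerm N c f) (r : ℂ) : HasLeadingTerm N (r * c) (r • f) :=
  (Tendsto.const_mul r hf).congr fun τ ↦ by rw [Pi.smul_apply, smul_eq_mul, mul_div_assoc]

lemma sub (hf : HasLeadingTerm N c f) (hg : HasLeadingTerm N d g) :
    HasLeadingTerm N (c - d) (f - g) :=
  (Tendsto.sub hf hg).congr fun τ ↦ by rw [Pi.sub_apply, sub_div]

lemma sum {ι : Type*} {s : Finset ι} {c : ι → ℂ} {f : ι → ℍ → ℂ}
    (hf : ∀ i ∈ s, HasLeadingTerm N (c i) (f i)) :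
    HasLeadingTerm N (∑ i ∈ s, c i) (∑ i ∈ s, f i) :=
  (tendsto_finsetSum s hf).congr fun τ ↦ by rw [Finset.sum_apply, Finset.sum_div]

lemma of_lt (hf : HasLeadingTerm N c f) (hMN : M < N) : HasLeadingTerm M 0 f := by
  obtain ⟨l, rfl⟩ : ∃ l : ℕ, N = M + (l + 1 : ℕ) := ⟨(N - M - 1).toNat, by omega⟩
  have h := Tendsto.mul hf (tendsto_q.pow (l + 1))
  rw [zero_pow l.succ_ne_zero, mul_zero] at h
  refine h.congr fun τ ↦ ?_
  rw [zpow_add₀ (q_ne_zero τ), zpow_natCast, div_mul_eq_div_div,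
    div_mul_cancel₀ _ (pow_ne_zero _ (q_ne_zero τ))]

lemma exists_add_one (hper : ∀ τ : ℍ, f ((1 : ℝ) +ᵥ τ) = f τ) (hf : MDiff f)
    (h0 : HasLeadingTerm N 0 f) : ∃ c, HasLeadingTerm (N + 1) c f := by
  set g : ℍ → ℂ := f / q ^ N with hg
  have hgper := periodic_comp_ofComplex (f := g) fun τ ↦ by simp [hg, hper, q_one_vadd]
  have hgm : MDiff g :=
    hf.div (mdifferentiable_zpow mdifferentiable_q q_ne_zero N) fun τ ↦ zpow_ne_zero N (q_ne_zero τ)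
  have hg0 : IsZeroAtImInfty g := h0
  have hderiv := (analyticAt_cuspFunction_zero one_pos hgper hgm
    hg0.isBoundedAtImInfty).differentiableAt.hasDerivAt
  refine ⟨_, ((hasDerivAt_iff_tendsto_slope.mp hderiv).comp
    (tendsto_nhdsWithin_iff.mpr ⟨tendsto_q, .of_forall q_ne_zero⟩)).congr fun τ ↦ ?_⟩
  rw [Function.comp_apply, slope_def_field, hg0.cuspFunction_apply_zero one_pos, q_eq_qParam,
    eq_cuspFunction τ one_ne_zero hgper, sub_zero, sub_zero, ← q_eq_qParam, hg, Pi.div_apply,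
    Pi.pow_apply, zpow_add_one₀ (q_ne_zero τ), div_div]

lemma meromorphicAt_cuspFunction (hper : ∀ τ : ℍ, f ((1 : ℝ) +ᵥ τ) = f τ) (hf : MDiff f)
    (hc : HasLeadingTerm N c f) : MeromorphicAt (cuspFunction 1 f) 0 := by
  set g : ℍ → ℂ := f / q ^ N with hg
  have hgper := periodic_comp_ofComplex (f := g) fun τ ↦ by simp [hg, hper, q_one_vadd]
  have hgm : MDiff g :=
    hf.div (mdifferentiable_zpow mdifferentiable_q q_ne_zero N) fun τ ↦ zpow_ne_zero N (q_ne_zero τ)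
  have hgan := analyticAt_cuspFunction_zero one_pos hgper hgm (Tendsto.isBigO_one ℝ hc)
  refine (hgan.meromorphicAt.mul ((MeromorphicAt.id 0).zpow N)).congr ?_
  filter_upwards [self_mem_nhdsWithin,
    nhdsWithin_le_nhds (Metric.ball_mem_nhds (0 : ℂ) one_pos)] with w hw hw1
  obtain ⟨τ, rfl⟩ : ∃ τ : ℍ, q τ = w :=
    ⟨⟨_, Function.Periodic.im_invQParam_pos_of_norm_lt_one one_pos (mem_ball_zero_iff.mp hw1) hw⟩,
      by rw [q_eq_qParam]; exact Function.Periodic.qParam_right_inv one_ne_zero hw⟩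
  rw [Pi.mul_apply, Pi.pow_apply, id_eq, q_eq_qParam, eq_cuspFunction τ one_ne_zero hgper,
    eq_cuspFunction τ one_ne_zero (periodic_comp_ofComplex hper), ← q_eq_qParam, hg, Pi.div_apply,
    Pi.pow_apply, div_mul_cancel₀ _ (zpow_ne_zero N (q_ne_zero τ))]

end HasLeadingTerm

lemma HasPrincipalPart.hasLeadingTerm {F : ℍ → ℂ} {P : Polynomial ℂ} (hP : HasPrincipalPart F P) :
    HasLeadingTerm (-P.natDegree) P.leadingCoeff F := by
  obtain ⟨ε, hε, hO⟩ := hP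
  have hrem : Tendsto (fun τ ↦ (F τ - P.eval (q τ)⁻¹) * q τ ^ P.natDegree) atImInfty (𝓝 0) := by
    simpa using (hO.trans_tendsto (tendsto_exp_neg_mul_im hε)).mul (tendsto_q.pow P.natDegree)
  have hmain : Tendsto (fun τ ↦ P.reverse.eval (q τ)) atImInfty (𝓝 P.leadingCoeff) := by
    rw [← Polynomial.coeff_zero_reverse, Polynomial.coeff_zero_eq_eval_zero]
    exact (P.reverse.continuous.tendsto 0).comp tendsto_q
  rw [← zero_add P.leadingCoeff]
  refine (hrem.add hmain).congr fun τ ↦ ?_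
  have hq := q_ne_zero τ
  have hreverse : P.reverse.eval (q τ) = P.eval (q τ)⁻¹ * q τ ^ P.natDegree := by
    let _ : Invertible (q τ)⁻¹ := invertibleOfNonzero (inv_ne_zero hq)
    have h := Polynomial.eval₂_reverse_mul_pow (RingHom.id ℂ) (q τ)⁻¹ P
    rw [invOf_eq_inv, inv_inv, Polynomial.eval₂_id, Polynomial.eval₂_id] at h
    rw [← h, inv_pow, inv_mul_cancel_right₀ (pow_ne_zero _ hq)]
  rw [hreverse, sub_mul, sub_add_cancel, zpow_neg, zpow_natCast, div_inv_eq_mul]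

/-! ### Modularity and reflection symmetry -/

/-- The transformation law of weight `κ` under `SL₂(ℤ)`. This is invariance under the slash action,
written pointwise so that it is inherited by products and powers. -/
def IsModularOfWeight (κ : ℤ) (f : ℍ → ℂ) : Prop :=
  ∀ (γ : SL(2, ℤ)) (τ : ℍ), f (γ • τ) = denom γ τ ^ κ * f τ

lemma isModularOfWeight_iff_slash_eq {κ : ℤ} {f : ℍ → ℂ} :
    IsModularOfWeight κ f ↔ ∀ γ : SL(2, ℤ), f ∣[κ] γ = f := by
  refine forall_congr' fun γ ↦ ?_
  rw [funext_iff]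
  refine forall_congr' fun τ ↦ ?_
  rw [ModularForm.SL_slash_apply, zpow_neg, ← div_eq_mul_inv,
    div_eq_iff (zpow_ne_zero κ (denom_ne_zero _ τ)), mul_comm]

lemma isModularOfWeight_zero_iff {f : ℍ → ℂ} :
    IsModularOfWeight 0 f ↔ ∀ (γ : SL(2, ℤ)) (τ : ℍ), f (γ • τ) = f τ := by
  simp [IsModularOfWeight]

lemma isModularOfWeight_coe {κ : ℤ} (f : ModularForm 𝒮ℒ κ) : IsModularOfWeight κ f :=
  isModularOfWeight_iff_slash_eq.mpr fun γ ↦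
    SlashInvariantForm.slash_action_eqn f.toSlashInvariantForm (γ : GL (Fin 2) ℝ) ⟨γ, rfl⟩

namespace IsModularOfWeight

variable {κ l : ℤ} {f g : ℍ → ℂ}

lemma mul (hf : IsModularOfWeight κ f) (hg : IsModularOfWeight l g) :
    IsModularOfWeight (κ + l) (f * g) := fun γ τ ↦ by
  simp only [Pi.mul_apply, hf γ τ, hg γ τ, zpow_add₀ (denom_ne_zero _ τ)]
  ring

lemma zpow (hf : IsModularOfWeight κ f) (n : ℤ) : IsModularOfWeight (κ * n) (f ^ n) := fun γ τ ↦ by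
  simp only [Pi.pow_apply, hf γ τ, mul_zpow, zpow_mul]

lemma pow (hf : IsModularOfWeight κ f) (n : ℕ) : IsModularOfWeight (κ * n) (f ^ n) :=
  mod_cast hf.zpow n

lemma const_smul (hf : IsModularOfWeight κ f) (c : ℂ) : IsModularOfWeight κ (c • f) := fun γ τ ↦ by
  simp only [Pi.smul_apply, hf γ τ, smul_eq_mul, mul_left_comm]

lemma sub (hf : IsModularOfWeight κ f) (hg : IsModularOfWeight κ g) :
    IsModularOfWeight κ (f - g) := fun γ τ ↦ by
  simp only [Pi.sub_apply, hf γ τ, hg γ τ, mul_sub]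

lemma one_vadd (hf : IsModularOfWeight κ f) (τ : ℍ) : f ((1 : ℝ) +ᵥ τ) = f τ := by
  rw [← UpperHalfPlane.modular_T_smul, hf, ModularGroup.denom_apply]
  simp [ModularGroup.T]

lemma even (hf : IsModularOfWeight κ f) (h0 : f ≠ 0) : Even κ := by
  by_contra hκ
  rw [Int.not_even_iff_odd] at hκ
  refine h0 (funext fun τ ↦ self_eq_neg.mp ?_)
  have hdenom : denom ((-1 : SL(2, ℤ)) : GL (Fin 2) ℝ) τ = -1 := by simp [denom]
  have h := hf (-1) τ
  rwa [ModularGroup.SL_neg_smul, one_smul, hdenom, hκ.neg_one_zpow, neg_one_mul] at h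

end IsModularOfWeight

/-- `f(-τ̄) = conj f(τ)`. For a periodic function this says that its Fourier coefficients in `u` are
real. -/
def IsConjEquivariant (f : ℍ → ℂ) : Prop := ∀ τ : ℍ, f (J • τ) = conj (f τ)

namespace IsConjEquivariant

variable {f g : ℍ → ℂ}

lemma mul (hf : IsConjEquivariant f) (hg : IsConjEquivariant g) : IsConjEquivariant (f * g) :=
  fun τ ↦ by simp only [Pi.mul_apply, hf τ, hg τ, map_mul]

lemma zpow (hf : IsConjEquivariant f) (n : ℤ) : IsConjEquivariant (f ^ n) :=
  fun τ ↦ by simp only [Pi.pow_apply, hf τ, map_zpow₀]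

lemma pow (hf : IsConjEquivariant f) (n : ℕ) : IsConjEquivariant (f ^ n) :=
  fun τ ↦ by simp only [Pi.pow_apply, hf τ, map_pow]

lemma sub (hf : IsConjEquivariant f) (hg : IsConjEquivariant g) : IsConjEquivariant (f - g) :=
  fun τ ↦ by simp only [Pi.sub_apply, hf τ, hg τ, map_sub]

lemma const_smul (hf : IsConjEquivariant f) {c : ℂ} (hc : conj c = c) :
    IsConjEquivariant (c • f) :=
  fun τ ↦ by simp only [Pi.smul_apply, smul_eq_mul, hf τ, map_mul, hc]

end IsConjEquivariant

lemma im_J_smul (τ : ℍ) : (J • τ).im = τ.im := by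
  rw [← coe_im, coe_J_smul]
  simp

/-! ### Eisenstein series, the discriminant and `j` -/

lemma hasLeadingTerm_E {k : ℕ} (hk : 3 ≤ k) (hk2 : Even k) :
    HasLeadingTerm 0 1 (ModularForm.E hk) := by
  rw [hasLeadingTerm_zero_iff]
  have hper := SlashInvariantFormClass.periodic_comp_ofComplex (ModularForm.E hk)
    one_mem_strictPeriods_SL
  have han := ModularFormClass.analyticAt_cuspFunction_zero (ModularForm.E hk) one_pos
    one_mem_strictPeriods_SL
  have hconst := EisensteinSeries.E_qExpansion_coeff_zero hk hk2
  rw [qExpansion_coeff_zero one_pos han hper,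
    ← UpperHalfPlane.cuspFunction_apply_zero one_pos han hper] at hconst
  rw [← hconst]
  refine (han.continuousAt.tendsto.comp tendsto_q).congr fun τ ↦ ?_
  rw [Function.comp_apply, q_eq_qParam]
  exact eq_cuspFunction τ one_ne_zero hper

lemma isConjEquivariant_E {k : ℕ} (hk : 3 ≤ k) (hk2 : Even k) :
    IsConjEquivariant (ModularForm.E hk) := fun τ ↦ by
  have hexp : cexp (2 * Real.pi * I * (J • τ : ℍ)) = conj (cexp (2 * Real.pi * I * τ)) := by
    simp [coe_J_smul, ← Complex.exp_conj, map_ofNat (starRingEnd ℂ)]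
  simp only [EisensteinSeries.q_expansion_bernoulli hk hk2, hexp, map_sub, map_one, map_mul,
    map_div₀, Complex.conj_tsum, map_zpow₀, map_natCast, map_ratCast, map_ofNat]

lemma isModularOfWeight_discriminant : IsModularOfWeight 12 ModularForm.discriminant :=
  isModularOfWeight_iff_slash_eq.mpr <| SlashInvariantForm.slash_action_generators_SL2Z
    ModularForm.discriminant_S_invariant ModularForm.discriminant_T_invariant

lemma mdifferentiable_discriminant : MDiff ModularForm.discriminant :=
  CuspFormClass.holo CuspForm.discriminant

lemma hasLeadingTerm_discriminant : HasLeadingTerm 1 1 ModularForm.discriminant :=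
  ModularForm.tendsto_atImInfty_tprod_one_sub_eta_q_pow.congr fun τ ↦ by
    rw [ModularForm.discriminant_eq_q_prod, ← q_eq_qParam, zpow_one,
      mul_div_cancel_left₀ _ (q_ne_zero τ)]

lemma isConjEquivariant_discriminant : IsConjEquivariant ModularForm.discriminant := fun τ ↦ by
  simp only [ModularForm.discriminant_eq_E₄_cube_sub_E₆_sq,
    isConjEquivariant_E _ (show Even 4 by decide) τ,
    isConjEquivariant_E _ (show Even 6 by decide) τ, map_div₀, map_sub, map_pow, map_ofNat]

lemma j_eq : j = ⇑ModularForm.E₄ ^ 3 * ModularForm.discriminant ^ (-1 : ℤ) := by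
  ext τ
  simp [j, div_eq_mul_inv]

lemma isModularOfWeight_j : IsModularOfWeight 0 j := by
  rw [j_eq]
  exact ((isModularOfWeight_coe ModularForm.E₄).pow 3).mul
    (isModularOfWeight_discriminant.zpow (-1))

lemma mdifferentiable_j : MDiff j :=
  (MDifferentiable.pow (ModularFormClass.holo ModularForm.E₄) 3).div mdifferentiable_discriminant
    ModularForm.discriminant_ne_zero

lemma hasLeadingTerm_j : HasLeadingTerm (-1) 1 j := by
  rw [j_eq]
  simpa using ((hasLeadingTerm_E _ (by decide : Even 4)).pow 3).mul
    (hasLeadingTerm_discriminant.zpow one_ne_zero (-1))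

lemma isConjEquivariant_j : IsConjEquivariant j := by
  rw [j_eq]
  exact ((isConjEquivariant_E _ (by decide)).pow 3).mul (isConjEquivariant_discriminant.zpow (-1))

lemma infinite_range_j : (Set.range j).Infinite := by
  intro hfin
  obtain ⟨C, hC⟩ := hfin.isBounded.exists_norm_le
  have hbdd : IsBoundedUnder (· ≤ ·) atImInfty (norm ∘ j) :=
    isBoundedUnder_of ⟨C, fun τ ↦ hC _ ⟨τ, rfl⟩⟩
  have hzero : HasLeadingTerm (-1) 0 j :=
    (tendsto_q.zero_mul_isBoundedUnder_le hbdd).congr fun τ ↦ by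
      rw [zpow_neg_one, div_inv_eq_mul, mul_comm]
  exact one_ne_zero (hasLeadingTerm_j.unique hzero)

/-! ### The factor `Δ^b Ẽ` -/

/-- The form `Δ^{b(k)} Ẽ_k` of weight `k`, whose divisor is supported at the cusp and the elliptic
points. -/
def baseForm (k : ℤ) : ℍ → ℂ := ModularForm.discriminant ^ b k * Etilde k

lemma Etilde_eq (k : ℤ) : Etilde k =
    if k % 12 = 2 then ⇑ModularForm.E₄ ^ 2 * ⇑ModularForm.E₆ else if k % 12 = 4 then ModularForm.E₄
    else if k % 12 = 6 then ModularForm.E₆ else if k % 12 = 8 then ⇑ModularForm.E₄ ^ 2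
    else if k % 12 = 10 then ⇑ModularForm.E₄ * ⇑ModularForm.E₆ else 1 := by
  ext τ
  unfold Etilde
  split_ifs <;> rfl

lemma isModularOfWeight_Etilde {k : ℤ} (hk : Even k) :
    IsModularOfWeight (k - 12 * b k) (Etilde k) := by
  have hweight : k - 12 * b k = if k % 12 = 2 then 14 else k % 12 := by
    unfold b
    split_ifs <;> omega
  have h4 := isModularOfWeight_coe ModularForm.E₄
  have h6 := isModularOfWeight_coe ModularForm.E₆
  rw [hweight, Etilde_eq]
  split_ifs with h2 h4' h6' h8 h10
  · exact (h4.pow 2).mul h6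
  · rwa [h4']
  · rwa [h6']
  · rw [h8]
    exact h4.pow 2
  · rw [h10]
    exact h4.mul h6
  · have h0 : k % 12 = 0 := by
      obtain ⟨r, rfl⟩ := hk
      omega
    rw [h0, isModularOfWeight_zero_iff]
    exact fun _ _ ↦ rfl

lemma isModularOfWeight_baseForm {k : ℤ} (hk : Even k) : IsModularOfWeight k (baseForm k) := by
  simpa [baseForm] using
    (isModularOfWeight_discriminant.zpow (b k)).mul (isModularOfWeight_Etilde hk)

lemma mdifferentiable_baseForm (k : ℤ) : MDiff (baseForm k) := by
  have h4 : MDiff (ModularForm.E₄ : ℍ → ℂ) := ModularFormClass.holo _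
  have h6 : MDiff (ModularForm.E₆ : ℍ → ℂ) := ModularFormClass.holo _
  refine (mdifferentiable_zpow mdifferentiable_discriminant
    ModularForm.discriminant_ne_zero _).mul ?_
  rw [Etilde_eq]
  split_ifs
  exacts [(h4.pow 2).mul h6, h4, h6, h4.pow 2, h4.mul h6, mdifferentiable_const]

lemma hasLeadingTerm_baseForm (k : ℤ) : HasLeadingTerm (b k) 1 (baseForm k) := by
  have h4 : HasLeadingTerm 0 1 ModularForm.E₄ := hasLeadingTerm_E _ (by decide)
  have h6 : HasLeadingTerm 0 1 ModularForm.E₆ := hasLeadingTerm_E _ (by decide)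
  have hE : HasLeadingTerm 0 1 (Etilde k) := by
    rw [Etilde_eq]
    split_ifs
    exacts [by simpa using (h4.pow 2).mul h6, h4, h6, by simpa using h4.pow 2,
      by simpa using h4.mul h6, hasLeadingTerm_zero_iff.mpr tendsto_const_nhds]
  simpa [baseForm] using (hasLeadingTerm_discriminant.zpow one_ne_zero (b k)).mul hE

lemma isConjEquivariant_baseForm (k : ℤ) : IsConjEquivariant (baseForm k) := by
  have h4 : IsConjEquivariant ModularForm.E₄ := isConjEquivariant_E _ (by decide)
  have h6 : IsConjEquivariant ModularForm.E₆ := isConjEquivariant_E _ (by decide)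
  refine (isConjEquivariant_discriminant.zpow _).mul ?_
  rw [Etilde_eq]
  split_ifs
  exacts [(h4.pow 2).mul h6, h4, h6, h4.pow 2, h4.mul h6, fun τ ↦ (map_one _).symm]

/-! ### Invariant functions as polynomials in `j` -/

namespace IsModularOfWeight

variable {f : ℍ → ℂ} {c : ℂ}

/-- An invariant function that converges at `i∞`, as a modular form of weight zero. -/
def toModularForm (hinv : IsModularOfWeight 0 f) (hf : MDiff f) (hc : HasLeadingTerm 0 c f) :
    ModularForm 𝒮ℒ 0 where
  toFun := f
  slash_action_eq' := by
    rintro _ ⟨γ, rfl⟩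
    exact isModularOfWeight_iff_slash_eq.mp hinv γ
  holo' := hf
  bdd_at_cusps' hcusp := by
    rw [OnePoint.isBoundedAt_iff_forall_SL2Z
      (by simpa [Subgroup.IsArithmetic.isCusp_iff_isCusp_SL2Z] using hcusp)]
    intro γ _
    rw [isModularOfWeight_iff_slash_eq.mp hinv γ]
    exact (hasLeadingTerm_zero_iff.mp hc).isBigO_one ℝ

lemma eq_const (hinv : IsModularOfWeight 0 f) (hf : MDiff f) (hc : HasLeadingTerm 0 c f) :
    f = Function.const ℍ c := by
  obtain ⟨d, hd⟩ := ModularFormClass.levelOne_weight_zero_const (hinv.toModularForm hf hc)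
  have hd' : f = Function.const ℍ d := hd
  rw [hasLeadingTerm_zero_iff, hd'] at hc
  rw [hd', tendsto_nhds_unique tendsto_const_nhds hc]

lemma leadingCoeff_eq_zero_of_pos {N : ℤ} (hinv : IsModularOfWeight 0 f) (hf : MDiff f)
    (hc : HasLeadingTerm N c f) (hN : 0 < N) : c = 0 := by
  have hf0 : f = 0 := hinv.eq_const hf (hc.of_lt hN)
  refine hc.unique (tendsto_const_nhds.congr fun τ ↦ ?_)
  rw [hf0, Pi.zero_apply, zero_div]

lemma exists_polynomial_eval_j (N : ℕ) (hinv : IsModularOfWeight 0 f) (hf : MDiff f)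
    (hc : HasLeadingTerm (-N) c f) :
    ∃ P : Polynomial ℂ, P.natDegree ≤ N ∧ P.coeff N = c ∧ ∀ τ, P.eval (j τ) = f τ := by
  induction N generalizing f c with
  | zero =>
    refine ⟨.C c, by simp, by simp, fun τ ↦ ?_⟩
    rw [hinv.eq_const hf (by simpa using hc), Polynomial.eval_C, Function.const_apply]
  | succ N ih =>
    set g : ℍ → ℂ := f - c • j ^ (N + 1) with hg
    have hg_inv : IsModularOfWeight 0 g :=
      hinv.sub (.const_smul (by simpa using isModularOfWeight_j.pow (N + 1)) c)
    have hg_holo : MDiff g := hf.sub ((mdifferentiable_j.pow (N + 1)).const_smul c)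
    have hg_lead : HasLeadingTerm (-(N + 1 : ℕ)) 0 g := by
      have hpow : HasLeadingTerm (-(N + 1 : ℕ)) 1 (j ^ (N + 1)) := by
        simpa using hasLeadingTerm_j.pow (N + 1)
      have h := hc.sub (hpow.const_smul c)
      rwa [mul_one, sub_self] at h
    obtain ⟨d, hd⟩ := hg_lead.exists_add_one hg_inv.one_vadd hg_holo
    obtain ⟨P, hPdeg, -, hP⟩ := ih hg_inv hg_holo (by simpa using hd)
    refine ⟨P + .C c * .X ^ (N + 1), ?_, ?_, fun τ ↦ ?_⟩
    · exact (Polynomial.natDegree_add_le _ _).trans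
        (max_le (by omega) (Polynomial.natDegree_C_mul_X_pow_le _ _))
    · simp [Polynomial.coeff_eq_zero_of_natDegree_lt (Nat.lt_succ_of_le hPdeg)]
    · simp [hP, hg]

end IsModularOfWeight

lemma map_conj_eq_of_isConjEquivariant {P : Polynomial ℂ}
    (hP : IsConjEquivariant fun τ ↦ P.eval (j τ)) : P.map (starRingEnd ℂ) = P := by
  refine Polynomial.eq_of_infinite_eval_eq _ _ (infinite_range_j.mono ?_)
  rintro _ ⟨τ, rfl⟩
  have hj : j τ = conj (j (J • τ)) := by rw [isConjEquivariant_j, Complex.conj_conj]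
  have heval : P.eval (j (J • τ)) = conj (P.eval (j τ)) := hP τ
  calc (P.map (starRingEnd ℂ)).eval (j τ)
      = conj (P.eval (j (J • τ))) := by rw [hj, Polynomial.eval_map, Polynomial.eval₂_hom]
    _ = P.eval (j τ) := by rw [heval, Complex.conj_conj]

lemma exists_map_ofRealHom_eq {P : Polynomial ℂ} (hP : P.map (starRingEnd ℂ) = P) :
    ∃ Q : Polynomial ℝ, Q.map Complex.ofRealHom = P := by
  rw [← Polynomial.mem_lifts, Polynomial.lifts_iff_coeff_lifts]
  intro i
  refine ⟨_, Complex.conj_eq_iff_re.mp ?_⟩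
  rw [← Polynomial.coeff_map (starRingEnd ℂ), hP]

lemma IsModularOfWeight.exists_monic_real_polynomial {N : ℤ} {f : ℍ → ℂ}
    (hinv : IsModularOfWeight 0 f) (hf : MDiff f) (hlead : HasLeadingTerm (-N) 1 f)
    (hreal : IsConjEquivariant f) :
    ∃ P : Polynomial ℝ, P.Monic ∧ (P.natDegree : ℤ) = N ∧
      ∀ τ, (P.map Complex.ofRealHom).eval (j τ) = f τ := by
  have hN : 0 ≤ N := by
    by_contra! hN
    exact one_ne_zero (hinv.leadingCoeff_eq_zero_of_pos hf hlead (neg_pos.mpr hN))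
  lift N to ℕ using hN
  obtain ⟨P, hPdeg, hPcoeff, hP⟩ := hinv.exists_polynomial_eval_j N hf hlead
  obtain ⟨Q, rfl⟩ := exists_map_ofRealHom_eq <| map_conj_eq_of_isConjEquivariant (P := P) fun τ ↦ by
    simp only [hP, hreal τ]
  rw [Polynomial.natDegree_map] at hPdeg
  have hQcoeff : Q.coeff N = 1 := by simpa using hPcoeff
  have hdeg : Q.natDegree = N :=
    le_antisymm hPdeg (Polynomial.le_natDegree_of_ne_zero (by simp [hQcoeff]))
  exact ⟨Q, by rw [Polynomial.Monic, Polynomial.leadingCoeff, hdeg, hQcoeff], mod_cast hdeg, hP⟩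


/-! ### Hecke operators preserve modularity -/

section FixedDeterminant

open FixedDetMatrices Matrix

section

variable {m : ℤ}

/-- Right multiplication of integral matrices of determinant `m` by `SL₂(ℤ)`. It permutes the
orbits of the left action, which index the terms of the Hecke operator. -/
def rightMul (A : FixedDetMatrix (Fin 2) ℤ m) (γ : SL(2, ℤ)) : FixedDetMatrix (Fin 2) ℤ m :=
  ⟨A.1 * γ.1, by rw [det_mul, A.2, γ.2, mul_one]⟩

lemma rightMul_smul (A : FixedDetMatrix (Fin 2) ℤ m) (g γ : SL(2, ℤ)) :
    rightMul (g • A) γ = g • rightMul A γ :=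
  Subtype.ext (Matrix.mul_assoc g.1 A.1 γ.1)

lemma rightMul_injective (γ : SL(2, ℤ)) :
    Function.Injective fun A : FixedDetMatrix (Fin 2) ℤ m ↦ rightMul A γ := fun A B h ↦ by
  have hγ : IsUnit γ.1 := (Matrix.isUnit_iff_isUnit_det _).mpr (by simp)
  exact Subtype.ext (hγ.mul_left_injective (congrArg Subtype.val h))

lemma exists_smul_eq_reduce (A : FixedDetMatrix (Fin 2) ℤ m) :
    ∃ g : SL(2, ℤ), g • A = reduce A := by
  induction A using reduce_rec with
  | step A h ih =>
    obtain ⟨g, hg⟩ := ih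
    rw [← reduce_reduceStep h, ← hg, reduceStep, smul_smul, smul_smul]
    exact ⟨_, rfl⟩
  | base A h =>
    by_cases h1 : 0 < A.1 0 0
    · exact ⟨_, (reduce_of_pos h h1).symm⟩
    · rw [reduce_of_not_pos h h1, smul_smul, smul_smul]
      exact ⟨_, rfl⟩

lemma apply_zero_zero_mul_apply_one_one {A : FixedDetMatrix (Fin 2) ℤ m} (hA : A.1 1 0 = 0) :
    A.1 0 0 * A.1 1 1 = m := by
  have h := A.2
  rwa [det_fin_two, hA, mul_zero, sub_zero] at h

lemma smul_apply_eq (g : SL(2, ℤ)) (A : FixedDetMatrix (Fin 2) ℤ m) (i l : Fin 2) :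
    (g • A).1 i l = g.1 i 0 * A.1 0 l + g.1 i 1 * A.1 1 l := by
  rw [smul_coe, mul_apply, Fin.sum_univ_two]

lemma upper_unipotent_of_smul {g : SL(2, ℤ)} {A : FixedDetMatrix (Fin 2) ℤ m}
    (hA : A.1 1 0 = 0) (hpos : 0 < A.1 0 0) (hgA : (g • A).1 1 0 = 0) (hgpos : 0 < (g • A).1 0 0) :
    g.1 1 0 = 0 ∧ g.1 0 0 = 1 ∧ g.1 1 1 = 1 := by
  rw [smul_apply_eq, hA, mul_zero, add_zero] at hgA hgpos
  have h10 : g.1 1 0 = 0 := (mul_eq_zero.mp hgA).resolve_right hpos.ne'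
  have hdet := g.2
  rw [det_fin_two, h10, mul_zero, sub_zero] at hdet
  have h00 : g.1 0 0 = 1 :=
    Int.eq_one_of_mul_eq_one_right (pos_of_mul_pos_left hgpos hpos.le).le hdet
  exact ⟨h10, h00, by rwa [h00, one_mul] at hdet⟩

end

variable {n : ℕ} [NeZero n]

lemma apply_one_one_pos {A : FixedDetMatrix (Fin 2) ℤ n} (hA : A ∈ reps n) : 0 < A.1 1 1 := by
  have hn : (0 : ℤ) < n := mod_cast NeZero.pos n
  rw [← apply_zero_zero_mul_apply_one_one hA.1] at hn
  exact pos_of_mul_pos_right hn hA.2.1.le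

lemma apply_zero_one_lt {A : FixedDetMatrix (Fin 2) ℤ n} (hA : A ∈ reps n) :
    A.1 0 1 < A.1 1 1 := by
  have h := hA.2.2.2
  rwa [abs_of_nonneg hA.2.2.1, abs_of_pos (apply_one_one_pos hA)] at h

lemma eq_one_of_smul_mem_reps {g : SL(2, ℤ)} {A : FixedDetMatrix (Fin 2) ℤ n} (hA : A ∈ reps n)
    (hgA : g • A ∈ reps n) : g = 1 := by
  obtain ⟨h10, h00, h11⟩ := upper_unipotent_of_smul hA.1 hA.2.1 hgA.1 hgA.2.1
  have hlt := apply_zero_one_lt hA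
  have hglt := apply_zero_one_lt hgA
  have hgnonneg := hgA.2.2.1
  rw [smul_apply_eq, smul_apply_eq, h00, h10, h11] at hglt
  rw [smul_apply_eq, h00] at hgnonneg
  have h01 : g.1 0 1 = 0 := by
    have hnonneg := hA.2.2.1
    by_contra! h
    rcases h.lt_or_gt with h | h <;> nlinarith
  ext i l
  fin_cases i <;> fin_cases l <;> simp [h00, h01, h10, h11]

lemma sum_reps {M : Type*} [AddCommMonoid M] (φ : ℤ → ℤ → ℤ → M) :
    ∑ A : reps n, φ (A.1.1 0 0) (A.1.1 0 1) (A.1.1 1 1) =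
      ∑ p ∈ n.divisorsAntidiagonal, ∑ b ∈ Finset.range p.2, φ p.1 b p.2 := by
  rw [Finset.sum_sigma']
  refine Finset.sum_bij'
    (fun A _ ↦ ⟨((A.1.1 0 0).toNat, (A.1.1 1 1).toNat), (A.1.1 0 1).toNat⟩)
    (fun x hx ↦ ⟨⟨!![(x.1.1 : ℤ), x.2; 0, x.1.2], ?det⟩, ?reps⟩) ?mem (fun _ _ ↦ Finset.mem_univ _)
    ?left ?right ?eq
  case det =>
    simp only [Finset.mem_sigma, Nat.mem_divisorsAntidiagonal] at hx
    simp [← hx.1.1]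
  case reps =>
    simp only [Finset.mem_sigma, Nat.mem_divisorsAntidiagonal, Finset.mem_range] at hx
    have hpos : 0 < x.1.1 := Nat.pos_of_ne_zero (left_ne_zero_of_mul (hx.1.1 ▸ hx.1.2))
    exact ⟨rfl, by simpa using hpos, by simp, by simpa using hx.2⟩
  case mem =>
    rintro ⟨A, hA⟩ -
    have hd := apply_one_one_pos hA
    have hlt := apply_zero_one_lt hA
    simp only [Finset.mem_sigma, Nat.mem_divisorsAntidiagonal, Finset.mem_range]
    refine ⟨⟨?_, NeZero.ne n⟩, by omega⟩
    rw [← Int.toNat_mul hA.2.1.le hd.le, apply_zero_zero_mul_apply_one_one hA.1, Int.toNat_natCast]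
  case left =>
    rintro ⟨A, hA⟩ -
    refine Subtype.ext (Subtype.ext ?_)
    ext i l
    fin_cases i <;> fin_cases l <;>
      simp [hA.1, hA.2.1.le, hA.2.2.1, (apply_one_one_pos hA).le]
  case right =>
    rintro ⟨⟨a, d⟩, b⟩ -
    simp
  case eq =>
    rintro ⟨A, hA⟩ -
    simp only [Int.toNat_of_nonneg hA.2.1.le, Int.toNat_of_nonneg hA.2.2.1,
      Int.toNat_of_nonneg (apply_one_one_pos hA).le]

/-- An integral matrix of determinant `n ≠ 0` as an element of `GL₂(ℝ)`. -/
def toGL (A : FixedDetMatrix (Fin 2) ℤ n) : GL (Fin 2) ℝ :=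
  .mkOfDetNeZero (A.1.map (Int.castRingHom ℝ)) <| by
    rw [← RingHom.mapMatrix_apply, ← RingHom.map_det, A.2]
    simpa using NeZero.ne n

lemma val_toGL (A : FixedDetMatrix (Fin 2) ℤ n) :
    (toGL A).val = A.1.map (Int.castRingHom ℝ) := rfl

lemma det_toGL (A : FixedDetMatrix (Fin 2) ℤ n) : (toGL A).det.val = n := by
  rw [GeneralLinearGroup.val_det_apply, val_toGL, ← RingHom.mapMatrix_apply, ← RingHom.map_det, A.2]
  simp

lemma det_toGL_pos (A : FixedDetMatrix (Fin 2) ℤ n) : 0 < (toGL A).det.val := by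
  rw [det_toGL]
  exact mod_cast NeZero.pos n

lemma toGL_smul (g : SL(2, ℤ)) (A : FixedDetMatrix (Fin 2) ℤ n) :
    toGL (g • A) = (g : GL (Fin 2) ℝ) * toGL A :=
  Units.ext Matrix.map_mul

lemma toGL_rightMul (A : FixedDetMatrix (Fin 2) ℤ n) (γ : SL(2, ℤ)) :
    toGL (rightMul A γ) = toGL A * (γ : GL (Fin 2) ℝ) :=
  Units.ext Matrix.map_mul

lemma denom_toGL {A : FixedDetMatrix (Fin 2) ℤ n} (hA : A.1 1 0 = 0) (τ : ℍ) :
    denom (toGL A) τ = A.1 1 1 := by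
  simp [denom, val_toGL, hA]

lemma toGL_smul_eq {A : FixedDetMatrix (Fin 2) ℤ n} (hA : A.1 1 0 = 0) (τ : ℍ) :
    toGL A • τ = ofComplex ((A.1 0 0 * τ + A.1 0 1) / A.1 1 1) := by
  rw [← ofComplex_apply (toGL A • τ), coe_smul_of_det_pos (det_toGL_pos A), denom_toGL hA]
  simp [num, val_toGL]

lemma slash_toGL (κ : ℤ) (f : ℍ → ℂ) {A : FixedDetMatrix (Fin 2) ℤ n} (hA : A.1 1 0 = 0) (τ : ℍ) :
    (f ∣[κ] toGL A) τ = (n : ℂ) ^ (κ - 1) * ((A.1 1 1 : ℂ) ^ (-κ) *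
      f (ofComplex ((A.1 0 0 * τ + A.1 0 1) / A.1 1 1))) := by
  have hσ : σ (toGL A) = .refl ℝ ℂ := by simp only [σ, if_pos (det_toGL_pos A)]
  rw [ModularForm.slash_apply, hσ, det_toGL, denom_toGL hA, toGL_smul_eq hA, Nat.abs_cast]
  simp only [ContinuousAlgEquiv.refl_apply, ofReal_natCast]
  ring

lemma hecke_eq_sum_slash (κ : ℤ) (f : ℍ → ℂ) :
    hecke κ n f = ∑ A : reps n, f ∣[κ] toGL A.1 := by
  ext τ
  have h := sum_reps (n := n) fun a b d ↦
    (n : ℂ) ^ (κ - 1) * ((d : ℂ) ^ (-κ) * f (ofComplex ((a * τ + b) / d)))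
  simp only [Finset.sum_apply, fun A : reps n ↦ slash_toGL κ f A.2.1 τ, h, hecke, Finset.mul_sum,
    Int.cast_natCast]

namespace IsModularOfWeight

variable {κ : ℤ} {f : ℍ → ℂ}

lemma slash_toGL_smul (hf : IsModularOfWeight κ f) (g : SL(2, ℤ))
    (A : FixedDetMatrix (Fin 2) ℤ n) : f ∣[κ] toGL (g • A) = f ∣[κ] toGL A := by
  rw [toGL_smul, SlashAction.slash_mul, ← ModularForm.SL_slash,
    isModularOfWeight_iff_slash_eq.mp hf]

-- Right multiplication by `γ` followed by reduction permutes the representatives.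
lemma hecke (hf : IsModularOfWeight κ f) : IsModularOfWeight κ (hecke κ n f) := by
  refine isModularOfWeight_iff_slash_eq.mpr fun γ ↦ ?_
  have hn : (n : ℤ) ≠ 0 := NeZero.ne _
  let r : reps (n : ℤ) → reps n := fun A ↦ ⟨reduce (rightMul A.1 γ), reduce_mem_reps hn _⟩
  have hr : Function.Injective r := fun A B h ↦ by
    obtain ⟨g, hg⟩ := exists_smul_eq_reduce (rightMul A.1 γ)
    obtain ⟨g', hg'⟩ := exists_smul_eq_reduce (rightMul B.1 γ)
    have h' : reduce (rightMul A.1 γ) = reduce (rightMul B.1 γ) := congrArg Subtype.val h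
    rw [← hg, ← hg', ← inv_smul_eq_iff, smul_smul, ← rightMul_smul] at h'
    have hAB : (g'⁻¹ * g) • A.1 = B.1 := rightMul_injective γ h'
    have hone : g'⁻¹ * g = 1 := eq_one_of_smul_mem_reps A.2 (hAB ▸ B.2)
    exact Subtype.ext (by rw [← hAB, hone, one_smul])
  rw [hecke_eq_sum_slash, ModularForm.SL_slash, SlashAction.sum_slash]
  refine Fintype.sum_bijective r (Finite.injective_iff_bijective.mp hr) _ _ fun A ↦ ?_
  obtain ⟨g, hg⟩ := exists_smul_eq_reduce (rightMul A.1 γ)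
  change _ = f ∣[κ] toGL (reduce (rightMul A.1 γ))
  rw [← hg, hf.slash_toGL_smul, toGL_rightMul, SlashAction.slash_mul]

end IsModularOfWeight

end FixedDeterminant

/-! ### Hecke translates -/

/-- The point `(aτ + b) / d`. This is a junk value if `a = 0` or `d = 0`. -/
def affinePoint (a b d : ℕ) (τ : ℍ) : ℍ := ofComplex ((a * τ + b) / d)

lemma pos_of_mem_divisorsAntidiagonal {n : ℕ} {p : ℕ × ℕ} (hp : p ∈ n.divisorsAntidiagonal) :
    0 < p.1 ∧ 0 < p.2 := by
  obtain ⟨h, hn⟩ := Nat.mem_divisorsAntidiagonal.mp hp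
  exact ⟨Nat.pos_of_ne_zero (left_ne_zero_of_mul (h ▸ hn)),
    Nat.pos_of_ne_zero (right_ne_zero_of_mul (h ▸ hn))⟩

lemma hecke_eq (κ : ℤ) (n : ℕ) (f : ℍ → ℂ) :
    hecke κ n f = (n : ℂ) ^ (κ - 1) • ∑ p ∈ n.divisorsAntidiagonal,
      (p.2 : ℂ) ^ (-κ) • ∑ b ∈ Finset.range p.2, f ∘ affinePoint p.1 b p.2 := by
  ext τ
  simp only [hecke, Pi.smul_apply, Finset.sum_apply, Function.comp_apply, smul_eq_mul, affinePoint]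

section affinePoint

variable {a d : ℕ} (ha : 0 < a) (hd : 0 < d) (b : ℕ)

include ha hd

lemma coe_affinePoint (τ : ℍ) : (affinePoint a b d τ : ℂ) = (a * τ + b) / d := by
  have him : 0 < ((a * (τ : ℂ) + b) / d).im := by
    rw [Complex.div_natCast_im]
    simp only [add_im, mul_im, natCast_re, coe_im, natCast_im, zero_mul, add_zero]
    positivity
  rw [affinePoint, ofComplex_apply_of_im_pos him]

lemma im_affinePoint (τ : ℍ) : (affinePoint a b d τ).im = a / d * τ.im := by
  rw [← coe_im, coe_affinePoint ha hd, Complex.div_natCast_im]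
  simp only [add_im, mul_im, natCast_re, coe_im, natCast_im, zero_mul, add_zero]
  ring

lemma tendsto_affinePoint : Tendsto (affinePoint a b d) atImInfty atImInfty := by
  refine tendsto_comap_iff.mpr ?_
  have him : UpperHalfPlane.im ∘ affinePoint a b d = fun τ ↦ (a / d : ℝ) * τ.im :=
    funext (im_affinePoint ha hd b)
  rw [him]
  exact tendsto_comap.const_mul_atTop (by positivity)

end affinePoint

/-! ### The operator `ξ` -/

/-- `f` is differentiable as a function of the two real variables `u` and `v`. -/
def IsRealDifferentiable (f : ℍ → ℂ) : Prop := ∀ τ : ℍ, DifferentiableAt ℝ (f ∘ ofComplex) τ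

lemma IsHarmonicMaassForm.isRealDifferentiable {κ : ℤ} {f : ℍ → ℂ} (hf : IsHarmonicMaassForm κ f) :
    IsRealDifferentiable f := fun τ ↦
  (hf.smooth.differentiableOn (by simp)).differentiableAt (isOpen_upperHalfPlaneSet.mem_nhds τ.2)

lemma comp_affinePoint_comp_ofComplex (f : ℍ → ℂ) (a b d : ℕ) (τ : ℍ) :
    (f ∘ affinePoint a b d) ∘ ofComplex =ᶠ[𝓝 (τ : ℂ)]
      fun z ↦ (f ∘ ofComplex) ((a / d : ℝ) • z + (b / d : ℂ)) := by
  filter_upwards [isOpen_upperHalfPlaneSet.mem_nhds τ.2] with z hz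
  have h : (a * z + b) / d = (a / d : ℝ) • z + (b / d : ℂ) := by
    rw [Complex.real_smul]
    push_cast
    ring
  rw [Function.comp_apply, Function.comp_apply, affinePoint, ofComplex_apply_of_im_pos hz, h,
    Function.comp_apply]

lemma smul_coe_add_eq_coe_affinePoint {a d : ℕ} (ha : 0 < a) (hd : 0 < d) (b : ℕ) (τ : ℍ) :
    (a / d : ℝ) • (τ : ℂ) + (b / d : ℂ) = affinePoint a b d τ := by
  rw [coe_affinePoint ha hd, Complex.real_smul]
  push_cast
  ring

namespace IsRealDifferentiable

variable {f g : ℍ → ℂ}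

lemma continuous (hf : IsRealDifferentiable f) : Continuous f := by
  have h : f = (f ∘ ofComplex) ∘ ((↑) : ℍ → ℂ) := by
    ext τ
    simp
  rw [h]
  exact continuous_iff_continuousAt.mpr fun τ ↦
    ContinuousAt.comp (hf τ).continuousAt continuous_coe.continuousAt

lemma const_smul (hf : IsRealDifferentiable f) (c : ℂ) : IsRealDifferentiable (c • f) :=
  fun τ ↦ (hf τ).const_smul c

lemma sub (hf : IsRealDifferentiable f) (hg : IsRealDifferentiable g) :
    IsRealDifferentiable (f - g) :=
  fun τ ↦ (hf τ).sub (hg τ)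

lemma sum {ι : Type*} {s : Finset ι} {f : ι → ℍ → ℂ} (hf : ∀ i ∈ s, IsRealDifferentiable (f i)) :
    IsRealDifferentiable (∑ i ∈ s, f i) := fun τ ↦ by
  have h : (∑ i ∈ s, f i) ∘ ofComplex = ∑ i ∈ s, f i ∘ ofComplex := by
    ext z
    simp
  rw [h]
  exact DifferentiableAt.sum fun i hi ↦ hf i hi τ

lemma comp_affinePoint (hf : IsRealDifferentiable f) {a d : ℕ} (ha : 0 < a) (hd : 0 < d) (b : ℕ) :
    IsRealDifferentiable (f ∘ affinePoint a b d) := fun τ ↦ by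
  refine DifferentiableAt.congr_of_eventuallyEq ?_ (comp_affinePoint_comp_ofComplex f a b d τ)
  have h := hf (affinePoint a b d τ)
  rw [← smul_coe_add_eq_coe_affinePoint ha hd] at h
  exact DifferentiableAt.comp (g := f ∘ ofComplex) (τ : ℂ) h (by fun_prop)

lemma hecke (hf : IsRealDifferentiable f) (κ : ℤ) (n : ℕ) :
    IsRealDifferentiable (hecke κ n f) := by
  rw [hecke_eq]
  refine .const_smul (.sum fun p hp ↦ .const_smul (.sum fun b _ ↦ ?_) _) _
  obtain ⟨ha, hd⟩ := pos_of_mem_divisorsAntidiagonal hp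
  exact hf.comp_affinePoint ha hd b

end IsRealDifferentiable

/-- The coefficient `β` of a real linear map `z ↦ α z + β z̄`. It turns `∂f/∂z̄` into a linear
function of the real derivative of `f`. -/
def antilinearCoeff : (ℂ →L[ℝ] ℂ) →ₗ[ℂ] ℂ where
  toFun L := (L 1 + I * L I) / 2
  map_add' L M := by
    simp only [add_apply]
    ring
  map_smul' c L := by
    simp only [smul_apply, smul_eq_mul, RingHom.id_apply]
    ring

lemma xi_eq (κ : ℤ) (f : ℍ → ℂ) (τ : ℍ) : xi κ f τ =
    2 * I * (τ.im : ℂ) ^ κ * conj (antilinearCoeff (fderiv ℝ (f ∘ ofComplex) τ)) := rfl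

lemma xi_const_smul (κ : ℤ) (c : ℂ) (f : ℍ → ℂ) : xi κ (c • f) = conj c • xi κ f := by
  ext τ
  have h : (c • f) ∘ ofComplex = c • (f ∘ ofComplex) := rfl
  rw [Pi.smul_apply, xi_eq, xi_eq, h, fderiv_const_smul_field, Pi.smul_apply, map_smul, smul_eq_mul,
    smul_eq_mul, map_mul]
  ring

lemma xi_sub (κ : ℤ) {f g : ℍ → ℂ} (hf : IsRealDifferentiable f) (hg : IsRealDifferentiable g) :
    xi κ (f - g) = xi κ f - xi κ g := by
  ext τ
  have h : (f - g) ∘ ofComplex = f ∘ ofComplex - g ∘ ofComplex := rfl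
  rw [Pi.sub_apply, xi_eq, xi_eq, xi_eq, h, fderiv_sub (hf τ) (hg τ), map_sub, map_sub, mul_sub]

lemma xi_sum (κ : ℤ) {ι : Type*} {s : Finset ι} {f : ι → ℍ → ℂ}
    (hf : ∀ i ∈ s, IsRealDifferentiable (f i)) : xi κ (∑ i ∈ s, f i) = ∑ i ∈ s, xi κ (f i) := by
  ext τ
  have h : (∑ i ∈ s, f i) ∘ ofComplex = ∑ i ∈ s, f i ∘ ofComplex := by
    ext z
    simp
  rw [Finset.sum_apply, xi_eq, h, fderiv_sum fun i hi ↦ hf i hi τ, map_sum, map_sum, Finset.mul_sum]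
  exact Finset.sum_congr rfl fun i _ ↦ (xi_eq κ (f i) τ).symm

lemma xi_comp_affinePoint (κ : ℤ) (f : ℍ → ℂ) {a d : ℕ} (ha : 0 < a) (hd : 0 < d) (b : ℕ) :
    xi κ (f ∘ affinePoint a b d) = (a / d : ℂ) ^ (1 - κ) • (xi κ f ∘ affinePoint a b d) := by
  ext τ
  have hr : (a / d : ℂ) ≠ 0 := div_ne_zero (mod_cast ha.ne') (mod_cast hd.ne')
  have hfderiv : fderiv ℝ ((f ∘ affinePoint a b d) ∘ ofComplex) τ =
      (a / d : ℝ) • fderiv ℝ (f ∘ ofComplex) (affinePoint a b d τ) := by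
    rw [(comp_affinePoint_comp_ofComplex f a b d τ).fderiv_eq,
      fderiv_comp_smul (f := fun z ↦ (f ∘ ofComplex) (z + (b / d : ℂ))), fderiv_comp_add_right,
      smul_coe_add_eq_coe_affinePoint ha hd]
  rw [Pi.smul_apply, Function.comp_apply, xi_eq, xi_eq, hfderiv, LinearMap.map_smul_of_tower,
    Complex.real_smul, map_mul, conj_ofReal, im_affinePoint ha hd, smul_eq_mul, zpow_sub₀ hr,
    zpow_one]
  push_cast
  rw [mul_zpow]
  field_simp

lemma xi_hecke (k : ℤ) {n : ℕ} (hn : n ≠ 0) {f : ℍ → ℂ} (hf : IsRealDifferentiable f) :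
    (n : ℂ) ^ (k - 1) • xi (2 - k) (hecke (2 - k) n f) = hecke k n (xi (2 - k) f) := by
  have hn' : (n : ℂ) ≠ 0 := mod_cast hn
  have hdiff (p : ℕ × ℕ) (hp : p ∈ n.divisorsAntidiagonal) (b : ℕ) :
      IsRealDifferentiable (f ∘ affinePoint p.1 b p.2) :=
    hf.comp_affinePoint (pos_of_mem_divisorsAntidiagonal hp).1
      (pos_of_mem_divisorsAntidiagonal hp).2 b
  rw [hecke_eq, hecke_eq, xi_const_smul,
    xi_sum _ fun p hp ↦ .const_smul (.sum fun b _ ↦ hdiff p hp b) _, map_zpow₀, map_natCast,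
    smul_smul, ← zpow_add₀ hn', Finset.smul_sum, Finset.smul_sum]
  refine Finset.sum_congr rfl fun p hp ↦ ?_
  obtain ⟨ha, hd⟩ := pos_of_mem_divisorsAntidiagonal hp
  rw [xi_const_smul, xi_sum _ fun b _ ↦ hdiff p hp b,
    Finset.sum_congr rfl fun b _ ↦ xi_comp_affinePoint (2 - k) f ha hd b, ← Finset.smul_sum,
    smul_smul, smul_smul, smul_smul, ← (Nat.mem_divisorsAntidiagonal.mp hp).1]
  congr 1
  have ha' : (p.1 : ℂ) ≠ 0 := mod_cast ha.ne'
  have hd' : (p.2 : ℂ) ≠ 0 := mod_cast hd.ne'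
  obtain ⟨l, rfl⟩ : ∃ l, k = l + 1 := ⟨k - 1, by ring⟩
  have hexp₁ : l + 1 - 1 + (2 - (l + 1) - 1) = 0 := by ring
  have hexp₂ : -(2 - (l + 1)) = l - 1 := by ring
  have hexp₃ : 1 - (2 - (l + 1)) = l := by ring
  have hexp₄ : -(l + 1) = -l - 1 := by ring
  rw [hexp₁, hexp₂, hexp₃, hexp₄, map_zpow₀, map_natCast, Nat.cast_mul, zpow_zero,
    add_sub_cancel_right, mul_zpow, div_zpow, zpow_sub_one₀ hd', zpow_sub_one₀ hd', zpow_neg]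
  field_simp

lemma mdifferentiable_of_xi_eq_zero {κ : ℤ} {f : ℍ → ℂ} (hf : IsRealDifferentiable f)
    (h : xi κ f = 0) : MDiff f := by
  rw [UpperHalfPlane.mdifferentiable_iff]
  intro z hz
  refine DifferentiableAt.differentiableWithinAt ?_
  rw [differentiableAt_complex_iff_differentiableAt_real]
  refine ⟨hf ⟨z, hz⟩, ?_⟩
  have hv : (z.im : ℂ) ≠ 0 := ofReal_ne_zero.mpr (ne_of_gt hz)
  have hdbar : dbar (f ∘ ofComplex) z = 0 := by
    simpa [xi, zpow_ne_zero _ hv] using congrFun h ⟨z, hz⟩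
  rw [dbar, partialU, partialV, div_eq_zero_iff, or_iff_left two_ne_zero] at hdbar
  rw [smul_eq_mul]
  linear_combination -I * hdbar + (fderiv ℝ (f ∘ ofComplex) z I) * I_mul_I

/-! ### Real Fourier coefficients -/

section AddCircle

variable {T : ℝ} [Fact (0 < T)]

lemma eq_of_fourierCoeff_eq {f g : C(AddCircle T, ℂ)}
    (h : ∀ n, _root_.fourierCoeff f n = _root_.fourierCoeff g n) : f = g := by
  refine ContinuousMap.toLp_injective (p := 2) AddCircle.haarAddCircle (𝕜 := ℂ)
    (fourierBasis.repr.injective (lp.ext (funext fun n ↦ ?_)))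
  rw [fourierBasis_repr, fourierBasis_repr, fourierCoeff_toLp, fourierCoeff_toLp, h]

lemma fourierCoeff_conj_neg (f : AddCircle T → ℂ) (n : ℤ) :
    _root_.fourierCoeff (fun t ↦ conj (f (-t))) n = conj (_root_.fourierCoeff f n) := by
  rw [_root_.fourierCoeff, _root_.fourierCoeff, ← integral_conj,
    ← MeasureTheory.integral_neg_eq_self]
  refine MeasureTheory.integral_congr_ae (.of_forall fun t ↦ ?_)
  simp only [neg_neg, smul_eq_mul, map_mul, fourier_neg, Complex.conj_conj]
  simp [fourier_apply]

lemma apply_neg_of_conj_fourierCoeff_eq {f : C(AddCircle T, ℂ)}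
    (hf : ∀ n, conj (_root_.fourierCoeff f n) = _root_.fourierCoeff f n) (t : AddCircle T) :
    f (-t) = conj (f t) := by
  let g : C(AddCircle T, ℂ) := ⟨fun t ↦ conj (f (-t)), by fun_prop⟩
  have hg : g = f := eq_of_fourierCoeff_eq fun n ↦ (fourierCoeff_conj_neg f n).trans (hf n)
  have h : conj (f (- -t)) = f (-t) := DFunLike.congr_fun hg (-t)
  rw [← h, neg_neg]

end AddCircle

/-- The restriction of a periodic function to the horizontal line of height `v`, as a function of
`u` modulo `1`. -/
def horizontalLine (f : ℍ → ℂ) (hf : Continuous f) (hper : ∀ τ : ℍ, f ((1 : ℝ) +ᵥ τ) = f τ) (v : ℝ)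
    (hv : 0 < v) : C(AddCircle (1 : ℝ), ℂ) where
  toFun := Function.Periodic.lift (f := fun u : ℝ ↦ f (ofComplex (u + v * I))) (c := 1) fun u ↦ by
    have h := periodic_comp_ofComplex hper (u + v * I)
    rw [← add_right_comm, ← ofReal_add] at h
    exact h
  continuous_toFun := by
    refine Continuous.quotient_liftOn' ?_ _
    refine hf.comp (continuous_iff_continuousAt.mpr fun u ↦ ?_)
    refine ContinuousAt.comp (f := fun u : ℝ ↦ (u : ℂ) + v * I) ?_ (by fun_prop)
    exact (contMDiffAt_ofComplex (n := 0) (by simpa using hv)).continuousAt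

section horizontalLine

variable {f : ℍ → ℂ} {hf : Continuous f} {hper : ∀ τ : ℍ, f ((1 : ℝ) +ᵥ τ) = f τ}

lemma horizontalLine_coe {v : ℝ} (hv : 0 < v) (u : ℝ) :
    horizontalLine f hf hper v hv u = f (ofComplex (u + v * I)) := rfl

lemma fourierCoeff_horizontalLine {v : ℝ} (hv : 0 < v) (l : ℤ) :
    _root_.fourierCoeff (horizontalLine f hf hper v hv) l = fourierCoeff f l v := by
  rw [fourierCoeff_eq_intervalIntegral _ _ 0, fourierCoeff, zero_add, div_one, one_smul]
  refine intervalIntegral.integral_congr fun u _ ↦ ?_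
  simp only [fourier_coe_apply, horizontalLine_coe, smul_eq_mul, mul_comm]
  congr 2
  push_cast
  ring

lemma horizontalLine_re_im (τ : ℍ) : horizontalLine f hf hper τ.im τ.im_pos τ.re = f τ := by
  rw [horizontalLine_coe, UpperHalfPlane.re_add_im, ofComplex_apply]

end horizontalLine

lemma HasRealFourierCoeffs.isConjEquivariant {f : ℍ → ℂ} (hreal : HasRealFourierCoeffs f)
    (hf : Continuous f) (hper : ∀ τ : ℍ, f ((1 : ℝ) +ᵥ τ) = f τ) : IsConjEquivariant f := fun τ ↦ by
  have hcoeff (l : ℤ) : conj (_root_.fourierCoeff (horizontalLine f hf hper τ.im τ.im_pos) l) =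
      _root_.fourierCoeff (horizontalLine f hf hper τ.im τ.im_pos) l := by
    rw [fourierCoeff_horizontalLine, Complex.conj_eq_iff_im]
    exact hreal l τ.im τ.im_pos
  have h := apply_neg_of_conj_fourierCoeff_eq hcoeff (τ.re : AddCircle (1 : ℝ))
  have hJ : ((-τ.re : ℝ) : ℂ) + τ.im * I = (J • τ : ℍ) := by
    rw [coe_J_smul]
    apply Complex.ext <;> simp
  rwa [horizontalLine_re_im, ← AddCircle.coe_neg, horizontalLine_coe, hJ, ofComplex_apply] at h

lemma J_smul_ofComplex {z : ℂ} (hz : 0 < z.im) : J • ofComplex z = ofComplex (-conj z) := by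
  have h : 0 < (-conj z).im := by simpa using hz
  ext
  rw [coe_J_smul, ofComplex_apply_of_im_pos hz, ofComplex_apply_of_im_pos h]

lemma IsConjEquivariant.dbar_J_smul {f : ℍ → ℂ} (hf : IsConjEquivariant f) (τ : ℍ) :
    dbar (f ∘ ofComplex) (J • τ : ℍ) = -conj (dbar (f ∘ ofComplex) τ) := by
  let reflection : ℂ ≃L[ℝ] ℂ := conjCLE.trans (.neg ℝ)
  have hloc : f ∘ ofComplex =ᶠ[𝓝 ((J • τ : ℍ) : ℂ)]
      conjCLE ∘ (f ∘ ofComplex) ∘ reflection := by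
    filter_upwards [isOpen_upperHalfPlaneSet.mem_nhds (J • τ).2] with z hz
    change f (ofComplex z) = conj (f (ofComplex (-conj z)))
    rw [← J_smul_ofComplex hz, hf, Complex.conj_conj]
  have hreflection : reflection (J • τ : ℍ) = τ := by
    change -conj ((J • τ : ℍ) : ℂ) = τ
    simp [coe_J_smul]
  have hfderiv (w : ℂ) : fderiv ℝ (f ∘ ofComplex) (J • τ : ℍ) w =
      conj (fderiv ℝ (f ∘ ofComplex) τ (-conj w)) := by
    rw [hloc.fderiv_eq, ContinuousLinearEquiv.comp_fderiv,
      ContinuousLinearEquiv.comp_right_fderiv, hreflection]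
    rfl
  simp only [dbar, partialU, partialV, hfderiv, map_one, map_neg, conj_I, neg_neg, map_div₀,
    map_add, map_mul, map_ofNat]
  ring

lemma IsConjEquivariant.xi {f : ℍ → ℂ} (hf : IsConjEquivariant f) (κ : ℤ) :
    IsConjEquivariant (xi κ f) := fun τ ↦ by
  rw [WeakEigenform.xi, WeakEigenform.xi, hf.dbar_J_smul, im_J_smul]
  simp [map_ofNat (starRingEnd ℂ)]

lemma J_smul_affinePoint {a b d : ℕ} (ha : 0 < a) (hd : 0 < d) (hb : b ≤ d) (τ : ℍ) :
    (1 : ℝ) +ᵥ J • affinePoint a b d τ = affinePoint a (d - b) d (J • τ) := by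
  have hd' : (d : ℂ) ≠ 0 := mod_cast hd.ne'
  ext
  rw [coe_vadd, coe_J_smul, coe_affinePoint ha hd, coe_affinePoint ha hd, coe_J_smul,
    Nat.cast_sub hb]
  simp only [map_div₀, map_add, map_mul, map_natCast, ofReal_one]
  field_simp
  ring

lemma affinePoint_self {a d : ℕ} (ha : 0 < a) (hd : 0 < d) (τ : ℍ) :
    affinePoint a d d τ = (1 : ℝ) +ᵥ affinePoint a 0 d τ := by
  have hd' : (d : ℂ) ≠ 0 := mod_cast hd.ne'
  ext
  rw [coe_vadd, coe_affinePoint ha hd, coe_affinePoint ha hd, ofReal_one, Nat.cast_zero]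
  field_simp
  ring

lemma sum_range_sub_of_apply_eq_apply_zero {M : Type*} [AddCommMonoid M] {φ : ℕ → M} {d : ℕ}
    (h : φ d = φ 0) : ∑ b ∈ Finset.range d, φ (d - b) = ∑ b ∈ Finset.range d, φ b := by
  cases d with
  | zero => rfl
  | succ d =>
    rw [Finset.sum_range_succ' φ, Finset.sum_range_succ', Nat.sub_zero, h,
      ← Finset.sum_range_reflect (fun i ↦ φ (i + 1))]
    congr 1
    refine Finset.sum_congr rfl fun i hi ↦ congrArg φ ?_
    have := Finset.mem_range.mp hi
    omega

lemma IsConjEquivariant.hecke {f : ℍ → ℂ} (hf : IsConjEquivariant f)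
    (hper : ∀ τ : ℍ, f ((1 : ℝ) +ᵥ τ) = f τ) (κ : ℤ) (n : ℕ) :
    IsConjEquivariant (hecke κ n f) := fun τ ↦ by
  have hsum (p : ℕ × ℕ) (hp : p ∈ n.divisorsAntidiagonal) :
      ∑ b ∈ Finset.range p.2, f (affinePoint p.1 b p.2 (J • τ)) =
        ∑ b ∈ Finset.range p.2, conj (f (affinePoint p.1 b p.2 τ)) := by
    obtain ⟨ha, hd⟩ := pos_of_mem_divisorsAntidiagonal hp
    rw [← sum_range_sub_of_apply_eq_apply_zero (by rw [affinePoint_self ha hd, hper])]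
    refine Finset.sum_congr rfl fun b hb ↦ ?_
    rw [← J_smul_affinePoint ha hd (Finset.mem_range.mp hb).le, hper, hf]
  simp only [hecke_eq, Pi.smul_apply, Finset.sum_apply, Function.comp_apply, smul_eq_mul, map_mul,
    map_sum, map_zpow₀, map_natCast]
  congr 1
  exact Finset.sum_congr rfl fun p hp ↦ congrArg _ (hsum p hp)

lemma IsConjEquivariant.conj_eq_of_smul {f : ℍ → ℂ} (hf : IsConjEquivariant f) (h0 : f ≠ 0) {c : ℂ}
    (hc : IsConjEquivariant (c • f)) : conj c = c := by
  obtain ⟨τ, hτ⟩ := Function.ne_iff.mp h0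
  have h := hc τ
  rw [Pi.smul_apply, Pi.smul_apply, hf τ, smul_eq_mul, smul_eq_mul, map_mul] at h
  exact (mul_right_cancel₀ ((map_ne_zero conj).mpr hτ) h).symm

/-! ### The Hecke operators at the cusp -/

lemma q_affinePoint_one (a : ℕ) (ha : 0 < a) (τ : ℍ) : q (affinePoint a 0 1 τ) = q τ ^ a := by
  rw [q, q, coe_affinePoint ha one_pos, ← Complex.exp_nat_mul]
  congr 1
  push_cast
  ring

lemma norm_q_affinePoint {a d : ℕ} (ha : 0 < a) (hd : 0 < d) (b : ℕ) (N M : ℤ) (τ : ℍ) :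
    ‖q (affinePoint a b d τ) ^ N / q τ ^ M‖ =
      Real.exp (-(2 * Real.pi * ((a * N - d * M) / d)) * τ.im) := by
  have hd' : (d : ℝ) ≠ 0 := mod_cast hd.ne'
  rw [norm_div, norm_zpow, norm_zpow, norm_q, norm_q, im_affinePoint ha hd, ← Real.rpow_intCast,
    ← Real.rpow_intCast, ← Real.exp_mul, ← Real.exp_mul, ← Real.exp_sub]
  congr 1
  field_simp
  ring

namespace HasLeadingTerm

variable {N M : ℤ} {c : ℂ} {f : ℍ → ℂ}

lemma comp_affinePoint_one (hf : HasLeadingTerm N c f) {a : ℕ} (ha : 0 < a) :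
    HasLeadingTerm (a * N) c (f ∘ affinePoint a 0 1) :=
  (hf.comp (tendsto_affinePoint ha one_pos 0)).congr fun τ ↦ by
    rw [Function.comp_apply, Function.comp_apply, q_affinePoint_one a ha, zpow_mul, zpow_natCast]

lemma comp_affinePoint_of_lt (hf : HasLeadingTerm N c f) {a d : ℕ} (ha : 0 < a) (hd : 0 < d) (b : ℕ)
    (hlt : d * M < a * N) : HasLeadingTerm M 0 (f ∘ affinePoint a b d) := by
  have hpos : 0 < 2 * Real.pi * ((a * N - d * M) / d : ℝ) := by
    have hlt' : 0 < (a * N - d * M : ℝ) := sub_pos.mpr (mod_cast hlt)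
    positivity
  have hq : Tendsto (fun τ ↦ q (affinePoint a b d τ) ^ N / q τ ^ M) atImInfty (𝓝 0) :=
    tendsto_zero_iff_norm_tendsto_zero.mpr <|
      (tendsto_exp_neg_mul_im hpos).congr fun τ ↦ (norm_q_affinePoint ha hd b N M τ).symm
  have h := (hf.comp (tendsto_affinePoint ha hd b)).mul hq
  rw [mul_zero] at h
  refine h.congr fun τ ↦ ?_
  rw [Function.comp_apply, Function.comp_apply,
    div_mul_div_cancel₀ (zpow_ne_zero N (q_ne_zero _))]

lemma hecke (hf : HasLeadingTerm N c f) (hN : N < 0) (κ : ℤ) {n : ℕ} (hn : n ≠ 0) :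
    HasLeadingTerm (n * N) ((n : ℂ) ^ (κ - 1) * c) (hecke κ n f) := by
  have hterm (p : ℕ × ℕ) (hp : p ∈ n.divisorsAntidiagonal) :
      HasLeadingTerm (n * N) (if p = (n, 1) then c else 0)
        ((p.2 : ℂ) ^ (-κ) • ∑ b ∈ Finset.range p.2, f ∘ affinePoint p.1 b p.2) := by
    obtain ⟨ha, hd⟩ := pos_of_mem_divisorsAntidiagonal hp
    obtain ⟨hpn, -⟩ := Nat.mem_divisorsAntidiagonal.mp hp
    split_ifs with h
    · simpa [h] using hf.comp_affinePoint_one (Nat.pos_of_ne_zero hn)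
    · have hd2 : 1 < p.2 := by
        refine lt_of_le_of_ne hd fun hd1 ↦ h ?_
        rw [← hpn, ← hd1, mul_one, hd1]
      have ha_lt : p.1 < p.2 * n := by
        rw [← hpn, mul_left_comm]
        exact lt_mul_of_one_lt_right ha (Nat.one_lt_mul_iff.mpr ⟨hd, hd, .inl hd2⟩)
      have hlt : (p.2 * (n * N) : ℤ) < p.1 * N := by
        rw [← mul_assoc]
        exact mul_lt_mul_of_neg_right (mod_cast ha_lt) hN
      simpa using (HasLeadingTerm.sum fun b _ ↦
        hf.comp_affinePoint_of_lt ha hd b hlt).const_smul ((p.2 : ℂ) ^ (-κ))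
  rw [hecke_eq]
  have h := (HasLeadingTerm.sum hterm).const_smul ((n : ℂ) ^ (κ - 1))
  rwa [Finset.sum_ite_eq_of_mem' _ _ _ (by simp [hn])] at h

end HasLeadingTerm

/-! ### The defect of a weak eigenform -/

/-- The function `n^(k-1) F | T_{2-k}(n) - α F`, which measures how far `F` is from being an
eigenform with eigenvalue `α`, in the normalization matching that of the shadow. By definition
`H_n(F)` is the product of `baseForm (k - 2)` and `heckeDefect k n (a n) F`. -/
def heckeDefect (k : ℤ) (n : ℕ) (α : ℂ) (F : ℍ → ℂ) : ℍ → ℂ :=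
  (n : ℂ) ^ (k - 1) • hecke (2 - k) n F - α • F

section heckeDefect

variable {k : ℤ} {n : ℕ} {α : ℂ} {F : ℍ → ℂ}

lemma conj_eigenvalue_eq (hn : n ≠ 0) (hF : IsRealDifferentiable F) (hFJ : IsConjEquivariant F)
    (hper : ∀ τ : ℍ, F ((1 : ℝ) +ᵥ τ) = F τ) (h0 : xi (2 - k) F ≠ 0)
    (heigen : hecke k n (xi (2 - k) F) = α • xi (2 - k) F) : conj α = α := by
  refine (hFJ.xi (2 - k)).conj_eq_of_smul h0 ?_
  rw [← heigen, ← xi_hecke k hn hF]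
  exact ((hFJ.hecke hper (2 - k) n).xi (2 - k)).const_smul (by simp)

lemma mdifferentiable_heckeDefect (hn : n ≠ 0) (hF : IsRealDifferentiable F)
    (heigen : hecke k n (xi (2 - k) F) = α • xi (2 - k) F) (hα : conj α = α) :
    MDiff (heckeDefect k n α F) := by
  have hdiff := (hF.hecke (2 - k) n).const_smul ((n : ℂ) ^ (k - 1))
  refine mdifferentiable_of_xi_eq_zero (κ := 2 - k) (hdiff.sub (hF.const_smul α)) ?_
  rw [heckeDefect, xi_sub _ hdiff (hF.const_smul α), xi_const_smul, xi_const_smul, map_zpow₀,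
    map_natCast, xi_hecke k hn hF, heigen, hα, sub_self]

lemma IsModularOfWeight.heckeDefect (hF : IsModularOfWeight (2 - k) F) (hn : n ≠ 0) (α : ℂ) :
    IsModularOfWeight (2 - k) (heckeDefect k n α F) :=
  have : NeZero n := ⟨hn⟩
  (hF.hecke.const_smul _).sub (hF.const_smul α)

lemma IsConjEquivariant.heckeDefect (hF : IsConjEquivariant F)
    (hper : ∀ τ : ℍ, F ((1 : ℝ) +ᵥ τ) = F τ) (hα : conj α = α) :
    IsConjEquivariant (heckeDefect k n α F) :=
  ((hF.hecke hper (2 - k) n).const_smul (by simp)).sub (hF.const_smul hα)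

lemma HasLeadingTerm.heckeDefect {N : ℤ} {c : ℂ} (hF : HasLeadingTerm N c F) (hN : N < 0)
    (hn : 1 < n) (k : ℤ) (α : ℂ) : HasLeadingTerm (n * N) c (heckeDefect k n α F) := by
  have hn0 : n ≠ 0 := by omega
  have hlt : n * N < N := mul_lt_of_one_lt_left hN (mod_cast hn)
  have h := ((hF.hecke hN (2 - k) hn0).const_smul ((n : ℂ) ^ (k - 1))).sub
    ((hF.of_lt hlt).const_smul α)
  rwa [← mul_assoc, ← zpow_add₀ (mod_cast hn0), show k - 1 + (2 - k - 1) = 0 by ring, zpow_zero,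
    one_mul, mul_zero, sub_zero] at h

end heckeDefect

end WeakEigenform

end

open WeakEigenform in
theorem theorem1_general (k : ℤ) (m : ℕ) (hm : 1 ≤ m) (F : UpperHalfPlane → ℂ) (a : ℕ → ℂ)
    (hF : IsRealDifferentiable F) (hmod : IsModularOfWeight (2 - k) F)
    (hreal : HasRealFourierCoeffs F) (hlead : HasLeadingTerm (-m) 1 F) (h0 : xi (2 - k) F ≠ 0)
    (n : ℕ) (hn : 2 ≤ n) (heigen : hecke k n (xi (2 - k) F) = a n • xi (2 - k) F) :
    IsWeaklyHolomorphicFunction (H k a n F) ∧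
      ∃ Pn : Polynomial ℝ, Pn.Monic ∧ (Pn.natDegree : ℤ) = (m : ℤ) * n - b (k - 2) ∧
        ∀ τ : UpperHalfPlane, (Pn.map Complex.ofRealHom).eval (j τ) = H k a n F τ := by
  have hn0 : n ≠ 0 := by omega
  have hF0 : F ≠ 0 := fun h ↦ one_ne_zero (hlead.unique (h ▸ by simp [HasLeadingTerm]))
  have hk : Even (k - 2) := by simpa using (hmod.even hF0).neg
  have hFJ := hreal.isConjEquivariant hF.continuous hmod.one_vadd
  have hα := conj_eigenvalue_eq hn0 hF hFJ hmod.one_vadd h0 heigen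
  have hmodH : IsModularOfWeight 0 (H k a n F) := by
    have h := (isModularOfWeight_baseForm hk).mul (hmod.heckeDefect hn0 (a n))
    rwa [sub_add_sub_cancel, sub_self] at h
  have hholoH : MDiff (H k a n F) :=
    (mdifferentiable_baseForm (k - 2)).mul (mdifferentiable_heckeDefect hn0 hF heigen hα)
  have hleadH : HasLeadingTerm (-(m * n - b (k - 2))) 1 (H k a n F) := by
    have h := (hasLeadingTerm_baseForm (k - 2)).mul (hlead.heckeDefect (by omega) hn k (a n))
    rwa [mul_one, mul_neg, ← sub_eq_add_neg, ← neg_sub, mul_comm] at h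
  have hconjH : IsConjEquivariant (H k a n F) :=
    (isConjEquivariant_baseForm (k - 2)).mul (hFJ.heckeDefect hmod.one_vadd hα)
  exact ⟨⟨isModularOfWeight_zero_iff.mp hmodH, hholoH,
    hleadH.meromorphicAt_cuspFunction hmodH.one_vadd hholoH⟩,
    hmodH.exists_monic_real_polynomial hholoH hleadH hconjH⟩

theorem theorem1 (k : ℤ) (m : ℕ) (hm : 1 ≤ m) (F : UpperHalfPlane → ℂ) (a : ℕ → ℂ)
    (hF : WeakEigenform.IsWeakEigenform k F a)
    (P : Polynomial ℂ) (hP : WeakEigenform.HasPrincipalPart F P)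
    (hPmonic : P.Monic) (hPdeg : P.natDegree = m) :
    ∀ n : ℕ, 2 ≤ n →
      WeakEigenform.IsWeaklyHolomorphicFunction (WeakEigenform.H k a n F) ∧
      ∃ Pn : Polynomial ℝ, Pn.Monic ∧
        (Pn.natDegree : ℤ) = (m : ℤ) * n - WeakEigenform.b (k - 2) ∧
        ∀ τ : UpperHalfPlane,
          (Pn.map Complex.ofRealHom).eval (WeakEigenform.j τ) = WeakEigenform.H k a n F τ := by
  intro n hn
  exact theorem1_general k m hm F a hF.maass.isRealDifferentiable
    (WeakEigenform.isModularOfWeight_iff_slash_eq.mpr hF.maass.slash_eq) hF.real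
    (by simpa [hPdeg, hPmonic.leadingCoeff] using hP.hasLeadingTerm) hF.shadow.1 n hn
    (hF.shadow.2 n (by omega))
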